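/- Let $q$ be an odd prime power and let $\mathbf{F}_q$ be the field with $q$ elements. Let $\mathrm{sym}(n)$ be the number of invertible symmetric $n\times n$ matrices over $\mathbf{F}_q$. For $0\le k\le n$, let $\mathrm{sym}_0(n,k)$ be the number of invertible symmetric $n\times n$ matrices over $\mathbf{F}_q$ whose first $k$ diagonal entries are $0$, and let $\mathrm{sym}_0^+(n,k)$ be the number of those whose determinant is a square in $\mathbf{F}_q$. Write $[n]_q=\frac{q^n-1}{q-1}$ and $[n]_q!!=[n]_q[n-2]_q[n-4]_q\cdots$ (the last factor being $[1]_q$ or $[2]_q$), with $[0]_q!!=[-1]_q!!=1$, and $\binom{a}{-1}=0$. Let $m,k\ge 0$ be integers. (1) If $k+1\le 2m$, then $$\mathrm{sym}_0(2m,k+1)=\frac{1}{q^{k+1}}\,\mathrm{sym}(2m).$$ (2) If $k+1\le 2m+1$, then $$\mathrm{sym}_0(2m+1,k+1)=\frac{q^{m^2+m}}{q^{k+1}}\sum_{j=0}^{\lfloor k/2\rfloor+1}(-1)^j(q-1)^{m+j}\,[2m-2j+1]_q!!\left(\binom{k+1}{2j-1}+(q-1)\binom{k+1}{2j}\right).$$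 (3) If $k+1\le 2m$, then $$\mathrm{sym}_0^+(2m,k+1)=\frac{\mathrm{sym}(2m)}{2q^{k+1}}+\frac{(-1)^t q^{m^2}}{2q^{k+1}}\sum_{j=0}^{\lceil k/2\rceil}(-1)^j(q-1)^{m+j}\,[2m-2j-1]_q!!\left(\binom{k+1}{2j}+(q-1)\binom{k+1}{2j+1}\right),$$ where $t=0$ if $(-1)^m$ is a square in $\mathbf{F}_q$ and $t=1$ otherwise. (4) If $k+1\le 2m+1$, then $$\mathrm{sym}_0^+(2m+1,k+1)=\tfrac12\,\mathrm{sym}_0(2m+1,k+1).$$ -/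

import Mathlib

/-- Invertible symmetric `n × n` matrices over `F`. -/
def SymInv (F : Type*) [Field F] (n : ℕ) : Set (Matrix (Fin n) (Fin n) F) :=
  {A | A.IsSymm ∧ IsUnit A}

/-- Invertible symmetric `n × n` matrices over `F` whose first `k` diagonal entries are zero. -/
def Symz (F : Type*) [Field F] (n k : ℕ) : Set (Matrix (Fin n) (Fin n) F) :=
  {A | A.IsSymm ∧ IsUnit A ∧ ∀ i : Fin n, (i : ℕ) < k → A i i = 0}

/-- Invertible symmetric `n × n` matrices over `F` whose first `k` diagonal entries are zero and
whose determinant is a (nonzero) square in `F`, that is, whose quadratic character is `+`. -/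
def SymzPlus (F : Type*) [Field F] [Fintype F] [DecidableEq F] (n k : ℕ) :
    Set (Matrix (Fin n) (Fin n) F) :=
  {A | A ∈ Symz F n k ∧ quadraticChar F A.det = 1}

/-- The number of invertible symmetric `n × n` matrices. -/
noncomputable def sym (F : Type*) [Field F] (n : ℕ) : ℕ := (SymInv F n).ncard

/-- The number of invertible symmetric `n × n` matrices with first `k` diagonal entries zero. -/
noncomputable def symz (F : Type*) [Field F] (n k : ℕ) : ℕ := (Symz F n k).ncard

/-- The number of invertible symmetric `n × n` matrices with first `k` diagonal entries zero and
square determinant. -/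
noncomputable def symzPlus (F : Type*) [Field F] [Fintype F] [DecidableEq F] (n k : ℕ) : ℕ :=
  (SymzPlus F n k).ncard

/-- The `q`-number `[n]_q = (q ^ n - 1) / (q - 1)`. -/
def qNumber (q : ℚ) (n : ℤ) : ℚ := (q ^ n - 1) / (q - 1)

/-- The `q`-double factorial `[n]_q!! = [n]_q [n-2]_q [n-4]_q ⋯` for `n ≥ -1`, the last factor being
`[1]_q` or `[2]_q`; the product is empty for `n = 0` and `n = -1`, so `[0]_q!! = [-1]_q!! = 1`. -/
def qDoubleFactorial (q : ℚ) (n : ℤ) : ℚ :=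
  ∏ i ∈ Finset.range ((n + 1) / 2).toNat, qNumber q (n - 2 * (i : ℤ))

/-- The binomial coefficient `n` over `r` with an integer lower index; it is `0` when `r < 0`. -/
def binom (n : ℕ) (r : ℤ) : ℚ := if 0 ≤ r then (n.choose r.toNat : ℚ) else 0

open Classical in
/-- The exponent `t`: `0` if `(-1) ^ m` is a square in `F`, and `1` otherwise. -/
noncomputable def signExp (F : Type*) [Field F] (m : ℕ) : ℕ :=
  if IsSquare ((-1 : F) ^ m) then 0 else 1

open Matrix Finset

/-! Let χ be the quadratic character, ψ a primitive additive character, G the Gauss sum of χ. The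
counts are sums of η(det A) with η = 1 or η = χ (`detSum`): the first is `symz`, the second
`symzDiff`, the excess of square over nonsquare determinants.

One more zero diagonal entry is imposed through q·1[a = 0] = ∑_d ψ(da). The term d = 0 imposes
nothing. For d ≠ 0, sum over the border of a fixed complementary block B (`sum_border`). If B is
singular, the corner does not affect the determinant and the sum over it vanishes. If B is
invertible, the Schur complement splits the sum into a Gauss sum of η and that of the quadratic form
dB⁻¹, which equals χ(det dB⁻¹)Gⁿ. Thus η becomes ηχ in size n (`detSum_succ`), and summing the
remaining power of χ(d) over d gives q − 1 or 0 by parity. Even `symz` and odd `symzDiff` are merely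
divided by q at each step, while odd `symz` and even `symzDiff` feed each other.

The start k = 0 needs a second relation between k = 0 and k = 1: inversion exchanges matrices with
nonzero corner and those with nonzero complementary minor (`detSum_zero_sub_one`). The closed sums
satisfy the same recursions by Pascal's rule (`oddSum_succ`, `evenSum_succ`). -/

/-- The complex-valued quadratic character. -/
noncomputable def complexQuadraticChar (F : Type*) [Field F] [Fintype F] [DecidableEq F] :
    MulChar F ℂ :=
  (quadraticChar F).ringHomComp (Int.castRingHom ℂ)

/-! ### Gauss sums of nondegenerate quadratic forms -/

section GaussSums

variable {F : Type*} [Field F] [Fintype F] [DecidableEq F]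

theorem complexQuadraticChar_apply (a : F) :
    complexQuadraticChar F a = (quadraticChar F a : ℂ) := rfl

theorem complexQuadraticChar_isQuadratic : (complexQuadraticChar F).IsQuadratic :=
  (quadraticChar_isQuadratic F).comp _

theorem complexQuadraticChar_mul_self : complexQuadraticChar F * complexQuadraticChar F = 1 := by
  rw [← sq, complexQuadraticChar_isQuadratic.sq_eq_one]

theorem complexQuadraticChar_sq {a : F} (ha : a ≠ 0) : complexQuadraticChar F a ^ 2 = 1 := by
  rw [complexQuadraticChar_apply]
  exact_mod_cast quadraticChar_sq_one ha

theorem complexQuadraticChar_inv (a : F) :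
    complexQuadraticChar F a⁻¹ = complexQuadraticChar F a := by
  rcases eq_or_ne a 0 with rfl | ha
  · simp
  · have h : complexQuadraticChar F a⁻¹ * complexQuadraticChar F a = 1 := by
      rw [← map_mul, inv_mul_cancel₀ ha, map_one]
    have h2 := complexQuadraticChar_sq ha
    linear_combination complexQuadraticChar F a * h - complexQuadraticChar F a⁻¹ * h2

theorem complexQuadraticChar_ne_one (hF : ringChar F ≠ 2) : complexQuadraticChar F ≠ 1 := by
  obtain ⟨a, ha⟩ := quadraticChar_exists_neg_one hF
  intro h
  have h2 := complexQuadraticChar_apply a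
  have ha0 : a ≠ 0 := by rintro rfl; simp at ha
  rw [ha, h, MulChar.one_apply (isUnit_iff_ne_zero.2 ha0)] at h2
  norm_num at h2

theorem gaussSum_quadratic_mulShift (ψ : AddChar F ℂ) {d : F} (hd : d ≠ 0) :
    gaussSum (complexQuadraticChar F) (ψ.mulShift d) =
      complexQuadraticChar F d * gaussSum (complexQuadraticChar F) ψ := by
  have h := gaussSum_mulShift (complexQuadraticChar F) ψ (Units.mk0 d hd)
  rw [Units.val_mk0] at h
  rw [← h, ← mul_assoc, ← sq, complexQuadraticChar_sq hd, one_mul]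

omit [Fintype F] [DecidableEq F] in
theorem addChar_map_sum {ι : Type*} (ψ : AddChar F ℂ) (s : Finset ι) (f : ι → F) :
    ψ (∑ i ∈ s, f i) = ∏ i ∈ s, ψ (f i) :=
  map_prod ψ.toMonoidHom (fun i => Multiplicative.ofAdd (f i)) s

/-- The sum of an additive character over the values of a nonzero unary quadratic form. -/
theorem sum_addChar_mul_sq (hF : ringChar F ≠ 2) {ψ : AddChar F ℂ} (hψ : ψ.IsPrimitive)
    {d : F} (hd : d ≠ 0) :
    ∑ x : F, ψ (d * x ^ 2) =
      complexQuadraticChar F d * gaussSum (complexQuadraticChar F) ψ := by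
  have h1 : ∑ x : F, ψ (d * x ^ 2) =
      ∑ a : F, ∑ x ∈ univ.filter (fun x : F => x ^ 2 = a), ψ (d * x ^ 2) :=
    (sum_fiberwise univ (fun x : F => x ^ 2) (fun x => ψ (d * x ^ 2))).symm
  -- The equation x² = a has χ(a) + 1 solutions; the summand 1 then contributes a complete additive
  -- character sum, which is zero.
  have h2 : ∀ a : F, ∑ x ∈ univ.filter (fun x : F => x ^ 2 = a), ψ (d * x ^ 2) =
      (complexQuadraticChar F a + 1) * ψ.mulShift d a := by
    intro a
    rw [sum_congr rfl (g := fun _ => ψ.mulShift d a), sum_const, nsmul_eq_mul]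
    · congr 1
      have := quadraticChar_card_sqrts hF a
      rw [complexQuadraticChar_apply]
      rw [show univ.filter (fun x : F => x ^ 2 = a) = {x | x ^ 2 = a}.toFinset by ext; simp]
      exact_mod_cast this
    · intro x hx
      rw [(mem_filter.1 hx).2, AddChar.mulShift_apply]
  have h3 : ∑ a : F, ψ.mulShift d a = 0 :=
    AddChar.sum_eq_zero_of_ne_one (hψ hd)
  rw [h1, sum_congr rfl fun a _ => h2 a]
  simp only [add_mul, one_mul, sum_add_distrib]
  rw [h3, add_zero, ← gaussSum_quadratic_mulShift ψ hd]
  rfl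

omit [Fintype F] [DecidableEq F] in
/-- A symmetric matrix over a field of characteristic not two is congruent to a diagonal one. -/
theorem exists_congruent_diagonal (hF : ringChar F ≠ 2) {n : ℕ} {C : Matrix (Fin n) (Fin n) F}
    (hC : C.IsSymm) :
    ∃ (P : Matrix (Fin n) (Fin n) F) (D : Fin n → F), IsUnit P ∧ Pᵀ * C * P = diagonal D := by
  have h2 : (2 : F) ≠ 0 := Ring.two_ne_zero hF
  have : Invertible (2 : F) := invertibleOfNonzero h2
  have hB : LinearMap.IsSymm (Matrix.toBilin' C) := by
    refine ⟨fun x y => ?_⟩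
    simp only [Matrix.toBilin'_apply', RingHom.id_apply]
    rw [dotProduct_mulVec, ← mulVec_transpose, hC.eq, dotProduct_comm]
  obtain ⟨b, hb⟩ := LinearMap.BilinForm.exists_orthogonal_basis hB
  let c := b.reindex (finCongr (Module.finrank_fin_fun F))
  have hc : ∀ i j, i ≠ j → Matrix.toBilin' C (c i) (c j) = 0 := by
    intro i j hij
    simp only [c, Module.Basis.reindex_apply]
    exact hb (fun h => hij (by simpa using h))
  have key := LinearMap.BilinForm.toMatrix_mul_basis_toMatrix (Pi.basisFun F (Fin n)) c
    (Matrix.toBilin' C)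
  refine ⟨(Pi.basisFun F (Fin n)).toMatrix c, fun i => Matrix.toBilin' C (c i) (c i), ?_, ?_⟩
  · have := (Pi.basisFun F (Fin n)).invertibleToMatrix c
    exact isUnit_of_invertible _
  · have h : LinearMap.BilinForm.toMatrix (Pi.basisFun F (Fin n)) (Matrix.toBilin' C) = C := by
      ext i j
      simp [LinearMap.BilinForm.toMatrix_apply]
    rw [h] at key
    rw [key]
    ext i j
    rw [LinearMap.BilinForm.toMatrix_apply, diagonal_apply]
    split_ifs with hij
    · rw [hij]
    · exact hc i j hij

/-- The Gauss sum of a nondegenerate quadratic form. -/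
theorem sum_addChar_quadraticForm (hF : ringChar F ≠ 2) {ψ : AddChar F ℂ} (hψ : ψ.IsPrimitive)
    {n : ℕ} {C : Matrix (Fin n) (Fin n) F} (hC : C.IsSymm) (hdet : C.det ≠ 0) :
    ∑ v : Fin n → F, ψ (v ⬝ᵥ C *ᵥ v) =
      complexQuadraticChar F C.det * gaussSum (complexQuadraticChar F) ψ ^ n := by
  obtain ⟨P, D, hP, hD⟩ := exists_congruent_diagonal hF hC
  have hPdet : P.det ≠ 0 := by
    rw [Matrix.isUnit_iff_isUnit_det] at hP
    exact hP.ne_zero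
  -- Congruence changes the determinant by a square, invisible to χ, so the diagonal form yields
  -- χ(det C).
  have hprod : ∏ i, D i = P.det ^ 2 * C.det := by
    rw [← det_diagonal, ← hD, det_mul, det_mul, det_transpose]
    ring
  have hD0 : ∀ i, D i ≠ 0 := by
    have : ∏ i, D i ≠ 0 := by
      rw [hprod]
      exact mul_ne_zero (pow_ne_zero _ hPdet) hdet
    intro i
    exact prod_ne_zero_iff.1 this i (mem_univ i)
  have hbij : Function.Bijective (P.mulVec : (Fin n → F) → Fin n → F) :=
    Finite.injective_iff_bijective.1 (Matrix.mulVec_injective_of_isUnit hP)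
  rw [← hbij.sum_comp]
  have hval : ∀ w : Fin n → F, ψ ((P *ᵥ w) ⬝ᵥ C *ᵥ (P *ᵥ w)) = ∏ i, ψ (D i * w i ^ 2) := by
    intro w
    have : (P *ᵥ w) ⬝ᵥ C *ᵥ (P *ᵥ w) = ∑ i, D i * w i ^ 2 := by
      have hcongr : (P *ᵥ w) ⬝ᵥ C *ᵥ (P *ᵥ w) = w ⬝ᵥ (Pᵀ * C * P) *ᵥ w := by
        rw [← mulVec_mulVec, ← mulVec_mulVec, dotProduct_mulVec w, vecMul_transpose]
      rw [hcongr, hD]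
      simp only [dotProduct, mulVec_diagonal]
      exact sum_congr rfl fun i _ => by ring
    rw [this, addChar_map_sum]
  rw [sum_congr rfl fun w _ => hval w]
  have := prod_univ_sum (fun _ : Fin n => (univ : Finset F)) (fun i x => ψ (D i * x ^ 2))
  rw [Fintype.piFinset_univ] at this
  rw [← this, prod_congr rfl fun i _ => sum_addChar_mul_sq hF hψ (hD0 i), prod_mul_distrib,
    ← map_prod, hprod, map_mul, map_pow, complexQuadraticChar_sq hPdet, one_mul]
  simp

end GaussSums

/-! ### Bordered symmetric matrices and their determinants -/

/-- The matrix with corner entry `a`, first row and column completed by `v`, and lower right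
block `B`. -/
def bordered {F : Type*} {n : ℕ} (a : F) (v : Fin n → F) (B : Matrix (Fin n) (Fin n) F) :
    Matrix (Fin (n + 1)) (Fin (n + 1)) F :=
  Matrix.of (Fin.cons (Fin.cons a v) fun i => Fin.cons (v i) (B i))

/-- Symmetric matrices. -/
abbrev SymmMatrix (F : Type*) (n : ℕ) := {A : Matrix (Fin n) (Fin n) F // A.IsSymm}

section Bordered

variable {F : Type*} {n : ℕ}

@[simp] theorem bordered_zero_zero (a : F) (v : Fin n → F) (B : Matrix (Fin n) (Fin n) F) :
    bordered a v B 0 0 = a := rfl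

@[simp] theorem bordered_zero_succ (a : F) (v : Fin n → F) (B : Matrix (Fin n) (Fin n) F)
    (j : Fin n) : bordered a v B 0 j.succ = v j := rfl

@[simp] theorem bordered_succ_zero (a : F) (v : Fin n → F) (B : Matrix (Fin n) (Fin n) F)
    (i : Fin n) : bordered a v B i.succ 0 = v i := rfl

@[simp] theorem bordered_succ_succ (a : F) (v : Fin n → F) (B : Matrix (Fin n) (Fin n) F)
    (i j : Fin n) : bordered a v B i.succ j.succ = B i j := rfl

theorem bordered_isSymm (a : F) (v : Fin n → F) {B : Matrix (Fin n) (Fin n) F}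
    (hB : B.IsSymm) : (bordered a v B).IsSymm := by
  ext i j
  refine Fin.cases ?_ (fun i => ?_) i <;> refine Fin.cases ?_ (fun j => ?_) j <;>
    simp [transpose_apply, hB.apply]

theorem bordered_submatrix_succ (a : F) (v : Fin n → F) (B : Matrix (Fin n) (Fin n) F) :
    (bordered a v B).submatrix Fin.succ Fin.succ = B := rfl

/-- A symmetric matrix is determined by its corner, the rest of its first row and the
complementary block. -/
def borderEquiv (F : Type*) (n : ℕ) :
    SymmMatrix F n × (Fin n → F) × F ≃ SymmMatrix F (n + 1) where
  toFun x := ⟨bordered x.2.2 x.2.1 x.1.1, bordered_isSymm _ _ x.1.2⟩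
  invFun A := (⟨A.1.submatrix Fin.succ Fin.succ, A.2.submatrix _⟩, fun j => A.1 0 j.succ, A.1 0 0)
  left_inv x := rfl
  right_inv A := by
    apply Subtype.ext
    ext i j
    refine Fin.cases ?_ (fun i => ?_) i <;> refine Fin.cases ?_ (fun j => ?_) j <;>
      simp [A.2.apply]

theorem sum_symmMatrix_succ [Fintype F] [DecidableEq F] {M : Type*} [AddCommMonoid M]
    (f : Matrix (Fin (n + 1)) (Fin (n + 1)) F → M) :
    ∑ A : SymmMatrix F (n + 1), f A.1 =
      ∑ B : SymmMatrix F n, ∑ v : Fin n → F, ∑ a : F, f (bordered a v B.1) := by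
  rw [← (borderEquiv F n).sum_comp, Fintype.sum_prod_type]
  refine sum_congr rfl fun B _ => ?_
  rw [Fintype.sum_prod_type]
  rfl

variable [Field F]

/-- Expansion along the first column: every minor omits that column and hence the corner, which
therefore enters only as a coefficient. -/
theorem det_bordered_eq_add (a : F) (v : Fin n → F) (B : Matrix (Fin n) (Fin n) F) :
    (bordered a v B).det = a * B.det + (bordered 0 v B).det := by
  rw [det_succ_column_zero, det_succ_column_zero (bordered 0 v B), Fin.sum_univ_succ,
    Fin.sum_univ_succ]
  simp only [bordered_zero_zero, bordered_succ_zero, Fin.succAbove_zero, bordered_submatrix_succ]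
  have : ∀ i : Fin n, (bordered a v B).submatrix i.succ.succAbove Fin.succ =
      (bordered 0 v B).submatrix i.succ.succAbove Fin.succ := by
    intro i
    ext x y
    simp only [submatrix_apply]
    refine Fin.cases ?_ (fun z => ?_) (i.succ.succAbove x) <;> simp
  simp [this]

/-- Schur complement formula, with the corner translated so that the complement is exactly `a`. -/
theorem det_bordered (a : F) (v : Fin n → F) {B : Matrix (Fin n) (Fin n) F}
    (hB : B.det ≠ 0) :
    (bordered (a + v ⬝ᵥ B⁻¹ *ᵥ v) v B).det = a * B.det := by
  have hu : IsUnit B.det := isUnit_iff_ne_zero.2 hB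
  let _ := B.invertibleOfIsUnitDet hu
  let e : Unit ⊕ Fin n ≃ Fin (n + 1) :=
    (Equiv.sumComm _ _).trans ((Equiv.optionEquivSumPUnit (Fin n)).symm.trans
      (finSuccEquiv n).symm)
  have he0 : e (Sum.inl ()) = 0 := by simp [e]
  have he1 : ∀ i, e (Sum.inr i) = Fin.succ i := by intro i; simp [e]
  rw [← det_submatrix_equiv_self e]
  have : (bordered (a + v ⬝ᵥ B⁻¹ *ᵥ v) v B).submatrix e e =
      fromBlocks (Matrix.of fun _ _ => a + v ⬝ᵥ B⁻¹ *ᵥ v) (replicateRow Unit v)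
        (replicateCol Unit v) B := by
    ext i j
    rcases i with i | i <;> rcases j with j | j <;> simp [he0, he1]
  rw [this, det_fromBlocks₂₂, invOf_eq_nonsing_inv, mul_comm]
  congr 1
  rw [det_unique (n := Unit), Matrix.sub_apply, Matrix.mul_assoc]
  simp [mul_apply, dotProduct, mulVec]

end Bordered

/-! ### Character sums over all borders of a fixed block -/

section BorderSums

variable {F : Type*} [Field F] [Fintype F] [DecidableEq F] {n : ℕ}

omit [DecidableEq F] in
/-- The twisted sum over the corner entry vanishes when the complementary block is singular. -/
theorem sum_corner_of_det_eq_zero {ψ : AddChar F ℂ} (hψ : ψ.IsPrimitive) {d : F} (hd : d ≠ 0)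
    (η : MulChar F ℂ) (v : Fin n → F) {B : Matrix (Fin n) (Fin n) F} (hB : B.det = 0) :
    ∑ a : F, η (bordered a v B).det * ψ (d * a) = 0 := by
  have h : ∀ a : F, η (bordered a v B).det * ψ (d * a) =
      η (bordered 0 v B).det * ψ.mulShift d a := by
    intro a
    rw [det_bordered_eq_add, hB, mul_zero, zero_add, AddChar.mulShift_apply]
  rw [sum_congr rfl fun a _ => h a, ← mul_sum,
    AddChar.sum_eq_zero_of_ne_one (hψ hd), mul_zero]

theorem sum_border_of_det_ne_zero (hF : ringChar F ≠ 2) {ψ : AddChar F ℂ} (hψ : ψ.IsPrimitive)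
    {d : F} (hd : d ≠ 0) (η : MulChar F ℂ) {B : Matrix (Fin n) (Fin n) F} (hB : B.IsSymm)
    (hdet : B.det ≠ 0) :
    ∑ v : Fin n → F, ∑ a : F, η (bordered a v B).det * ψ (d * a) =
      gaussSum η (ψ.mulShift d) * complexQuadraticChar F d ^ n *
        gaussSum (complexQuadraticChar F) ψ ^ n * (η * complexQuadraticChar F) B.det := by
  have hinner : ∀ v : Fin n → F, ∑ a : F, η (bordered a v B).det * ψ (d * a) =
      η B.det * gaussSum η (ψ.mulShift d) * ψ (v ⬝ᵥ (d • B⁻¹) *ᵥ v) := by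
    intro v
    -- Translating the corner makes the Schur complement the variable; the translation itself leaves
    -- the phase of the form d·B⁻¹ at v.
    rw [← Equiv.sum_comp (Equiv.addRight (v ⬝ᵥ B⁻¹ *ᵥ v)), gaussSum, mul_sum, sum_mul]
    refine sum_congr rfl fun s _ => ?_
    rw [Equiv.coe_addRight, det_bordered s v hdet, map_mul, mul_add, AddChar.map_add_eq_mul,
      smul_mulVec, dotProduct_smul, smul_eq_mul, AddChar.mulShift_apply]
    ring
  have hsymm : (d • B⁻¹).IsSymm := by
    rw [IsSymm, transpose_smul, transpose_nonsing_inv, hB.eq]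
  have hdet' : (d • B⁻¹).det = d ^ n * B.det⁻¹ := by
    rw [det_smul, Fintype.card_fin, det_nonsing_inv, Ring.inverse_eq_inv']
  have hne : (d • B⁻¹).det ≠ 0 := by
    rw [hdet']
    exact mul_ne_zero (pow_ne_zero _ hd) (inv_ne_zero hdet)
  rw [sum_congr rfl fun v _ => hinner v, ← mul_sum, sum_addChar_quadraticForm hF hψ hsymm hne,
    hdet', map_mul, map_pow, complexQuadraticChar_inv, MulChar.mul_apply]
  ring

theorem sum_border (hF : ringChar F ≠ 2) {ψ : AddChar F ℂ} (hψ : ψ.IsPrimitive)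
    {d : F} (hd : d ≠ 0) (η : MulChar F ℂ) {B : Matrix (Fin n) (Fin n) F} (hB : B.IsSymm) :
    ∑ v : Fin n → F, ∑ a : F, η (bordered a v B).det * ψ (d * a) =
      gaussSum η (ψ.mulShift d) * complexQuadraticChar F d ^ n *
        gaussSum (complexQuadraticChar F) ψ ^ n * (η * complexQuadraticChar F) B.det := by
  by_cases hdet : B.det = 0
  · rw [sum_eq_zero fun v _ => sum_corner_of_det_eq_zero hψ hd η v hdet, hdet,
      MulChar.map_zero, mul_zero]
  · exact sum_border_of_det_ne_zero hF hψ hd η hB hdet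

omit [DecidableEq F] in
/-- Borders of an invertible matrix contribute equally. -/
theorem sum_border_untwisted (η : MulChar F ℂ) {B : Matrix (Fin n) (Fin n) F}
    (hdet : B.det ≠ 0) :
    ∑ v : Fin n → F, ∑ a : F, η (bordered a v B).det =
      (Fintype.card F : ℂ) ^ n * (∑ a : F, η a) * η B.det := by
  have hinner : ∀ v : Fin n → F, ∑ a : F, η (bordered a v B).det = (∑ a : F, η a) * η B.det := by
    intro v
    rw [← Equiv.sum_comp (Equiv.addRight (v ⬝ᵥ B⁻¹ *ᵥ v)), sum_mul]
    refine sum_congr rfl fun s _ => ?_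
    rw [Equiv.coe_addRight, det_bordered s v hdet, map_mul]
  rw [sum_congr rfl fun v _ => hinner v, sum_const, card_univ, Fintype.card_fun, Fintype.card_fin,
    nsmul_eq_mul]
  push_cast
  ring

end BorderSums

/-! ### Recursions for the determinant character sums -/

section Sums

variable {F : Type*} [Field F] [Fintype F] [DecidableEq F]

/-- The sum of a multiplicative character over the determinants of symmetric matrices whose first
`k` diagonal entries vanish. -/
noncomputable def detSum (η : MulChar F ℂ) (n k : ℕ) : ℂ :=
  ∑ A : SymmMatrix F n, if ∀ i : Fin n, (i : ℕ) < k → A.1 i i = 0 then η A.1.det else 0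

/-- Simultaneous permutation of rows and columns. -/
def symmReindex (F : Type*) {n : ℕ} (σ : Equiv.Perm (Fin n)) : SymmMatrix F n ≃ SymmMatrix F n where
  toFun A := ⟨A.1.submatrix σ σ, A.2.submatrix σ⟩
  invFun A := ⟨A.1.submatrix σ.symm σ.symm, A.2.submatrix σ.symm⟩
  left_inv A := by apply Subtype.ext; ext i j; simp
  right_inv A := by apply Subtype.ext; ext i j; simp

/-- A cyclic relabelling of the indices preserves the determinant. It frees the corner, so that the
k conditions fall on the complementary block. -/
theorem detSum_eq_sum_shift (η : MulChar F ℂ) {n k : ℕ} (hk : k ≤ n) :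
    detSum η (n + 1) k = ∑ A : SymmMatrix F (n + 1),
      if ∀ i : Fin n, (i : ℕ) < k → A.1 i.succ i.succ = 0 then η A.1.det else 0 := by
  rw [detSum, ← (symmReindex F (finRotate (n + 1))).sum_comp]
  refine sum_congr rfl fun A _ => ?_
  have hdet : ((symmReindex F (finRotate (n + 1))) A).1.det = A.1.det :=
    det_submatrix_equiv_self (finRotate (n + 1)) A.1
  rw [hdet]
  refine if_congr ?_ rfl rfl
  have hrot : ∀ i : Fin n, finRotate (n + 1) i.castSucc = i.succ := fun i =>
    finRotate_of_lt i.2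
  constructor
  · intro h i hi
    have := h i.castSucc hi
    simpa [symmReindex, hrot] using this
  · intro h i hi
    have := h ⟨i, by omega⟩ hi
    have h2 := hrot ⟨i, by omega⟩
    simp only [symmReindex, Equiv.coe_fn_mk, submatrix_apply]
    rw [show i = Fin.castSucc ⟨i, by omega⟩ from rfl, h2]
    exact this

theorem detSum_succ (hF : ringChar F ≠ 2) {ψ : AddChar F ℂ} (hψ : ψ.IsPrimitive)
    (η : MulChar F ℂ) {n k : ℕ} (hk : k ≤ n) :
    (Fintype.card F : ℂ) * detSum η (n + 1) (k + 1) = detSum η (n + 1) k +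
      (∑ d ∈ univ.erase (0 : F), gaussSum η (ψ.mulShift d) * complexQuadraticChar F d ^ n) *
        gaussSum (complexQuadraticChar F) ψ ^ n * detSum (η * complexQuadraticChar F) n k := by
  let P : Matrix (Fin n) (Fin n) F → Prop := fun B => ∀ i : Fin n, (i : ℕ) < k → B i i = 0
  have htwist : ∀ d : F, ∑ A : SymmMatrix F (n + 1),
      (if P (A.1.submatrix Fin.succ Fin.succ) then η A.1.det * ψ (d * A.1 0 0) else 0) =
      ∑ B : SymmMatrix F n,
        if P B.1 then ∑ v : Fin n → F, ∑ a : F, η (bordered a v B.1).det * ψ (d * a) else 0 := by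
    intro d
    rw [sum_symmMatrix_succ (fun A : Matrix (Fin (n + 1)) (Fin (n + 1)) F =>
      if P (A.submatrix Fin.succ Fin.succ) then η A.det * ψ (d * A 0 0) else 0)]
    refine sum_congr rfl fun B _ => ?_
    by_cases hP : P B.1
    · rw [if_pos hP]
      exact sum_congr rfl fun v _ => sum_congr rfl fun a _ => if_pos hP
    · rw [if_neg hP]
      exact sum_eq_zero fun v _ => sum_eq_zero fun a _ => if_neg hP
  have hleft : ∑ d : F, ∑ A : SymmMatrix F (n + 1),
      (if P (A.1.submatrix Fin.succ Fin.succ) then η A.1.det * ψ (d * A.1 0 0) else 0) =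
      (Fintype.card F : ℂ) * detSum η (n + 1) (k + 1) := by
    rw [sum_comm, detSum, mul_sum]
    refine sum_congr rfl fun A _ => ?_
    have hcond : (∀ i : Fin (n + 1), (i : ℕ) < k + 1 → A.1 i i = 0) ↔
        A.1 0 0 = 0 ∧ P (A.1.submatrix Fin.succ Fin.succ) := by
      simp [Fin.forall_fin_succ, P]
    rw [if_congr hcond rfl rfl]
    by_cases hP : P (A.1.submatrix Fin.succ Fin.succ)
    · simp only [hP, if_true, and_true]
      rw [← mul_sum, AddChar.sum_mulShift _ hψ]
      split_ifs <;> simp [mul_comm]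
    · simp [hP]
  -- The trivial character d = 0 leaves the corner free; the other d give the border sums.
  rw [← hleft, ← add_sum_erase _ _ (mem_univ (0 : F))]
  congr 1
  · rw [detSum_eq_sum_shift η hk]
    refine sum_congr rfl fun A _ => ?_
    simp [P]
  · rw [sum_mul, sum_mul]
    refine sum_congr rfl fun d hd => ?_
    rw [htwist, detSum, mul_sum]
    refine sum_congr rfl fun B _ => ?_
    rw [sum_border hF hψ (ne_of_mem_erase hd) η B.2]
    simp only [P, mul_ite, mul_zero]

omit [Fintype F] [DecidableEq F] in
theorem nonsing_inv_zero_zero {n : ℕ} (A : Matrix (Fin (n + 1)) (Fin (n + 1)) F) :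
    A⁻¹ 0 0 = A.det⁻¹ * (A.submatrix Fin.succ Fin.succ).det := by
  rw [Matrix.inv_def, Matrix.smul_apply, adjugate_fin_succ_eq_det_submatrix, Ring.inverse_eq_inv']
  simp

/-- Inversion exchanges a nonzero corner entry with a nonzero complementary minor. -/
theorem sum_corner_ne_zero {η : MulChar F ℂ} (hη : ∀ a, η a⁻¹ = η a) (n : ℕ) :
    ∑ A : SymmMatrix F (n + 1), (if A.1 0 0 ≠ 0 then η A.1.det else 0) =
      ∑ A : SymmMatrix F (n + 1),
        if (A.1.submatrix Fin.succ Fin.succ).det ≠ 0 then η A.1.det else 0 := by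
  -- Singular matrices contribute η(0) = 0; discarding them leaves a set on which `inv` is an
  -- involution.
  have hres : ∀ p : SymmMatrix F (n + 1) → Prop, ∀ _ : DecidablePred p,
      ∑ A : SymmMatrix F (n + 1), (if p A then η A.1.det else 0) =
        ∑ A ∈ univ.filter (fun A : SymmMatrix F (n + 1) => A.1.det ≠ 0),
          if p A then η A.1.det else 0 := by
    intro p _
    rw [sum_filter]
    refine sum_congr rfl fun A _ => ?_
    by_cases h : A.1.det = 0 <;> simp [h, MulChar.map_zero]
  rw [hres (fun A => A.1 0 0 ≠ 0) inferInstance,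
    hres (fun A => (A.1.submatrix Fin.succ Fin.succ).det ≠ 0) inferInstance]
  let inv : SymmMatrix F (n + 1) → SymmMatrix F (n + 1) := fun A =>
    ⟨A.1⁻¹, by rw [IsSymm, transpose_nonsing_inv, A.2.eq]⟩
  have hdet : ∀ A : SymmMatrix F (n + 1), (inv A).1.det = A.1.det⁻¹ := fun A => by
    rw [← Ring.inverse_eq_inv', ← det_nonsing_inv]
  have hmem : ∀ A ∈ univ.filter (fun A : SymmMatrix F (n + 1) => A.1.det ≠ 0),
      inv A ∈ univ.filter (fun A : SymmMatrix F (n + 1) => A.1.det ≠ 0) := by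
    intro A hA
    rw [mem_filter] at hA ⊢
    exact ⟨mem_univ _, by rw [hdet]; exact inv_ne_zero hA.2⟩
  have hinv : ∀ A ∈ univ.filter (fun A : SymmMatrix F (n + 1) => A.1.det ≠ 0),
      inv (inv A) = A := by
    intro A hA
    exact Subtype.ext (nonsing_inv_nonsing_inv _ (isUnit_iff_ne_zero.2 (mem_filter.1 hA).2))
  refine (sum_nbij' inv inv hmem hmem hinv hinv fun A hA => ?_).symm
  have h0 := (mem_filter.1 hA).2
  have hcorner : (inv A).1 0 0 = A.1.det⁻¹ * (A.1.submatrix Fin.succ Fin.succ).det :=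
    nonsing_inv_zero_zero A.1
  have hiff : (A.1.submatrix Fin.succ Fin.succ).det ≠ 0 ↔ (inv A).1 0 0 ≠ 0 := by
    rw [hcorner, mul_ne_zero_iff]
    exact ⟨fun h => ⟨inv_ne_zero h0, h⟩, fun h => h.2⟩
  exact if_congr hiff (by rw [hdet, hη]) rfl

/-- The difference counts nonzero corners, which inversion trades for invertible blocks; over such a
block all borders are summed by the Schur complement. -/
theorem detSum_zero_sub_one {η : MulChar F ℂ} (hη : ∀ a, η a⁻¹ = η a) (n : ℕ) :
    detSum η (n + 1) 0 - detSum η (n + 1) 1 =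
      (Fintype.card F : ℂ) ^ n * (∑ a : F, η a) * detSum η n 0 := by
  have h1 : detSum η (n + 1) 0 - detSum η (n + 1) 1 =
      ∑ A : SymmMatrix F (n + 1), if A.1 0 0 ≠ 0 then η A.1.det else 0 := by
    rw [detSum, detSum, ← sum_sub_distrib]
    refine sum_congr rfl fun A _ => ?_
    by_cases h : A.1 0 0 = 0 <;> simp [h]
  rw [h1, sum_corner_ne_zero hη,
    sum_symmMatrix_succ (fun A : Matrix (Fin (n + 1)) (Fin (n + 1)) F =>
      if (A.submatrix Fin.succ Fin.succ).det ≠ 0 then η A.det else 0), detSum, mul_sum]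
  refine sum_congr rfl fun B _ => ?_
  simp only [bordered_submatrix_succ]
  by_cases hB : B.1.det = 0
  · simp [hB, MulChar.map_zero]
  · simp only [ne_eq, hB, not_false_eq_true, if_true]
    rw [sum_border_untwisted η hB]
    simp

end Sums

/-! ### From character sums to counts, split by parity of the size -/

section Relations

variable {F : Type*} [Field F] [Fintype F] [DecidableEq F]

omit [Field F] in
theorem ncard_symmetric {n : ℕ} (p : Matrix (Fin n) (Fin n) F → Prop) [DecidablePred p] :
    (({A : Matrix (Fin n) (Fin n) F | A.IsSymm ∧ p A}.ncard : ℕ) : ℂ) =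
      ∑ A : SymmMatrix F n, if p A.1 then 1 else 0 := by
  have h : {A : Matrix (Fin n) (Fin n) F | A.IsSymm ∧ p A} =
      Subtype.val '' {A : SymmMatrix F n | p A.1} := by
    ext A
    simp [and_comm]
  rw [h, Set.ncard_image_of_injective _ Subtype.val_injective, Set.ncard_eq_toFinset_card',
    sum_boole]
  congr 3
  ext A
  simp

omit [Fintype F] [DecidableEq F] in
theorem isUnit_matrix_iff {n : ℕ} {A : Matrix (Fin n) (Fin n) F} : IsUnit A ↔ A.det ≠ 0 := by
  rw [Matrix.isUnit_iff_isUnit_det, isUnit_iff_ne_zero]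

theorem detSum_one_eq_symz (n k : ℕ) : detSum (1 : MulChar F ℂ) n k = (symz F n k : ℂ) := by
  have h : Symz F n k = {A | A.IsSymm ∧ (A.det ≠ 0 ∧ ∀ i : Fin n, (i : ℕ) < k → A i i = 0)} := by
    ext A
    simp only [Symz, Set.mem_ofPred_eq, isUnit_matrix_iff]
  rw [symz, h, ncard_symmetric, detSum]
  refine sum_congr rfl fun A _ => ?_
  by_cases hA : A.1.det = 0
  · simp [hA, MulChar.map_zero]
  · simp [hA, MulChar.one_apply (isUnit_iff_ne_zero.2 hA)]

/-- On nonzero determinants χ + 1 is twice the indicator of the squares. -/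
theorem detSum_quadratic_eq (n k : ℕ) :
    detSum (complexQuadraticChar F) n k = 2 * (symzPlus F n k : ℂ) - (symz F n k : ℂ) := by
  have h : SymzPlus F n k = {A | A.IsSymm ∧
      (quadraticChar F A.det = 1 ∧ ∀ i : Fin n, (i : ℕ) < k → A i i = 0)} := by
    ext A
    simp only [SymzPlus, Symz, Set.mem_ofPred_eq, isUnit_matrix_iff]
    constructor
    · rintro ⟨⟨h1, -, h2⟩, h3⟩
      exact ⟨h1, h3, h2⟩
    · rintro ⟨h1, h2, h3⟩
      refine ⟨⟨h1, fun h0 => ?_, h3⟩, h2⟩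
      rw [h0, MulChar.map_zero] at h2
      exact zero_ne_one h2
  rw [eq_sub_iff_add_eq, ← detSum_one_eq_symz, symzPlus, h, ncard_symmetric, detSum, detSum,
    ← sum_add_distrib, mul_sum]
  refine sum_congr rfl fun A _ => ?_
  by_cases hP : ∀ i : Fin n, (i : ℕ) < k → A.1 i i = 0
  · rw [if_pos hP, if_pos hP, complexQuadraticChar_apply]
    by_cases hA : A.1.det = 0
    · simp [hA, MulChar.map_zero]
    · rw [MulChar.one_apply (isUnit_iff_ne_zero.2 hA)]
      rcases quadraticChar_dichotomy hA with h1 | h1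
      · rw [h1, if_pos ⟨rfl, hP⟩]
        norm_num
      · rw [h1, if_neg (by norm_num)]
        norm_num
  · rw [if_neg hP, if_neg hP, if_neg (fun h => hP h.2)]
    norm_num

theorem sum_erase_zero_even_pow {r : ℕ} (hr : Even r) :
    ∑ d ∈ univ.erase (0 : F), complexQuadraticChar F d ^ r = (Fintype.card F : ℂ) - 1 := by
  obtain ⟨s, rfl⟩ := hr
  rw [sum_congr rfl (g := fun _ => (1 : ℂ))]
  · rw [sum_const, card_erase_of_mem (mem_univ _), card_univ, nsmul_eq_mul, mul_one,
      Nat.cast_sub Fintype.card_pos, Nat.cast_one]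
  · intro d hd
    rw [← two_mul, pow_mul, complexQuadraticChar_sq (ne_of_mem_erase hd), one_pow]

theorem sum_erase_zero_odd_pow (hF : ringChar F ≠ 2) {r : ℕ} (hr : Odd r) :
    ∑ d ∈ univ.erase (0 : F), complexQuadraticChar F d ^ r = 0 := by
  obtain ⟨s, rfl⟩ := hr
  rw [sum_congr rfl (g := fun d => complexQuadraticChar F d)]
  · have h := MulChar.sum_eq_zero_of_ne_one (complexQuadraticChar_ne_one hF)
    rw [← add_sum_erase _ _ (mem_univ (0 : F)), MulChar.map_zero, zero_add] at h
    exact h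
  · intro d hd
    rw [pow_succ, pow_mul, complexQuadraticChar_sq (ne_of_mem_erase hd), one_pow, one_mul]

theorem sum_one_mulChar : ∑ a : F, (1 : MulChar F ℂ) a = (Fintype.card F : ℂ) - 1 := by
  rw [MulChar.sum_one_eq_card_units, Fintype.card_units, Nat.cast_sub Fintype.card_pos,
    Nat.cast_one]

omit [Fintype F] [DecidableEq F] in
theorem one_mulChar_inv (a : F) : (1 : MulChar F ℂ) a⁻¹ = (1 : MulChar F ℂ) a := by
  rcases eq_or_ne a 0 with rfl | ha
  · simp
  · rw [MulChar.one_apply (isUnit_iff_ne_zero.2 ha),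
      MulChar.one_apply (isUnit_iff_ne_zero.2 (inv_ne_zero ha))]

/-- The Gauss sum of the trivial character against a nontrivial additive one is −1, hence the minus
sign. -/
theorem detSum_one_succ (hF : ringChar F ≠ 2) {ψ : AddChar F ℂ} (hψ : ψ.IsPrimitive)
    {n k : ℕ} (hk : k ≤ n) :
    (Fintype.card F : ℂ) * detSum (1 : MulChar F ℂ) (n + 1) (k + 1) =
      detSum (1 : MulChar F ℂ) (n + 1) k -
      (∑ d ∈ univ.erase (0 : F), complexQuadraticChar F d ^ n) *
        gaussSum (complexQuadraticChar F) ψ ^ n * detSum (complexQuadraticChar F) n k := by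
  rw [detSum_succ hF hψ 1 hk, one_mul, sub_eq_add_neg, ← neg_mul, ← neg_mul, ← sum_neg_distrib]
  congr 3
  refine sum_congr rfl fun d hd => ?_
  rw [gaussSum_one_left (hψ (ne_of_mem_erase hd)), neg_one_mul]

/-- Here the corner contributes χ(d)G, raising both exponents from `n` to `n + 1`; the parity of the
size that matters is thus opposite to that for η = 1. -/
theorem detSum_quadratic_succ (hF : ringChar F ≠ 2) {ψ : AddChar F ℂ} (hψ : ψ.IsPrimitive)
    {n k : ℕ} (hk : k ≤ n) :
    (Fintype.card F : ℂ) * detSum (complexQuadraticChar F) (n + 1) (k + 1) =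
      detSum (complexQuadraticChar F) (n + 1) k +
      (∑ d ∈ univ.erase (0 : F), complexQuadraticChar F d ^ (n + 1)) *
        gaussSum (complexQuadraticChar F) ψ ^ (n + 1) * detSum (1 : MulChar F ℂ) n k := by
  rw [detSum_succ hF hψ _ hk, complexQuadraticChar_mul_self]
  congr 2
  rw [pow_succ (gaussSum _ _), mul_comm _ (gaussSum (complexQuadraticChar F) ψ), ← mul_assoc]
  congr 1
  rw [sum_mul]
  refine sum_congr rfl fun d hd => ?_
  rw [gaussSum_quadratic_mulShift ψ (ne_of_mem_erase hd)]
  ring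

theorem gaussSum_pow_two_mul (hF : ringChar F ≠ 2) {ψ : AddChar F ℂ} (hψ : ψ.IsPrimitive)
    (m : ℕ) : gaussSum (complexQuadraticChar F) ψ ^ (2 * m) =
      (((quadraticChar F (-1) : ℤ) : ℂ) * (Fintype.card F : ℂ)) ^ m := by
  rw [pow_mul, gaussSum_sq (complexQuadraticChar_ne_one hF) complexQuadraticChar_isQuadratic hψ,
    complexQuadraticChar_apply]

/-- Twice the number of square determinants minus the number of all nonzero determinants. -/
noncomputable def symzDiff (F : Type*) [Field F] [Fintype F] [DecidableEq F] (n k : ℕ) : ℚ :=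
  2 * symzPlus F n k - symz F n k

theorem detSum_quadratic_eq_symzDiff (n k : ℕ) :
    detSum (complexQuadraticChar F) n k = ((symzDiff F n k : ℚ) : ℂ) := by
  rw [detSum_quadratic_eq, symzDiff]
  push_cast
  rfl

variable (hF : ringChar F ≠ 2)
include hF

theorem symz_even_succ {m k : ℕ} (hk : k ≤ 2 * m + 1) :
    (Fintype.card F : ℚ) * symz F (2 * m + 2) (k + 1) = symz F (2 * m + 2) k := by
  have h := detSum_one_succ hF (AddChar.FiniteField.primitiveChar_to_Complex_isPrimitive F) hk
  rw [sum_erase_zero_odd_pow hF ⟨m, rfl⟩, zero_mul, zero_mul, sub_zero, detSum_one_eq_symz,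
    detSum_one_eq_symz] at h
  exact_mod_cast h

theorem symz_odd_succ {m k : ℕ} (hk : k ≤ 2 * m) :
    (Fintype.card F : ℚ) * symz F (2 * m + 1) (k + 1) = symz F (2 * m + 1) k -
      ((Fintype.card F : ℚ) - 1) * ((quadraticChar F (-1) : ℤ) * (Fintype.card F : ℚ)) ^ m *
        symzDiff F (2 * m) k := by
  have hψ := AddChar.FiniteField.primitiveChar_to_Complex_isPrimitive F
  have h := detSum_one_succ hF hψ hk
  rw [sum_erase_zero_even_pow (even_two_mul m), gaussSum_pow_two_mul hF hψ, detSum_one_eq_symz,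
    detSum_one_eq_symz, detSum_quadratic_eq_symzDiff] at h
  exact_mod_cast h

theorem symzDiff_even_succ {m k : ℕ} (hk : k ≤ 2 * m + 1) :
    (Fintype.card F : ℚ) * symzDiff F (2 * m + 2) (k + 1) = symzDiff F (2 * m + 2) k +
      ((Fintype.card F : ℚ) - 1) * ((quadraticChar F (-1) : ℤ) * (Fintype.card F : ℚ)) ^ (m + 1) *
        symz F (2 * m + 1) k := by
  have hψ := AddChar.FiniteField.primitiveChar_to_Complex_isPrimitive F
  have h := detSum_quadratic_succ hF hψ hk
  rw [sum_erase_zero_even_pow (⟨m + 1, by ring⟩ : Even (2 * m + 1 + 1)),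
    show gaussSum (complexQuadraticChar F) (AddChar.FiniteField.primitiveChar_to_Complex F) ^
      (2 * m + 1 + 1) = gaussSum (complexQuadraticChar F)
        (AddChar.FiniteField.primitiveChar_to_Complex F) ^ (2 * (m + 1)) by rfl, gaussSum_pow_two_mul hF hψ, detSum_one_eq_symz,
    detSum_quadratic_eq_symzDiff, detSum_quadratic_eq_symzDiff] at h
  exact_mod_cast h

theorem symzDiff_odd_succ {m k : ℕ} (hk : k ≤ 2 * m) :
    (Fintype.card F : ℚ) * symzDiff F (2 * m + 1) (k + 1) = symzDiff F (2 * m + 1) k := by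
  have hψ := AddChar.FiniteField.primitiveChar_to_Complex_isPrimitive F
  have h := detSum_quadratic_succ hF hψ hk
  rw [sum_erase_zero_odd_pow hF ⟨m, rfl⟩, zero_mul, zero_mul, add_zero,
    detSum_quadratic_eq_symzDiff, detSum_quadratic_eq_symzDiff] at h
  exact_mod_cast h

omit hF in
theorem symz_zero_sub_one (n : ℕ) : (symz F (n + 1) 0 : ℚ) - symz F (n + 1) 1 =
    (Fintype.card F : ℚ) ^ n * ((Fintype.card F : ℚ) - 1) * symz F n 0 := by
  have h := detSum_zero_sub_one (one_mulChar_inv (F := F)) n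
  rw [sum_one_mulChar, detSum_one_eq_symz, detSum_one_eq_symz, detSum_one_eq_symz] at h
  exact_mod_cast h

theorem symzDiff_zero_eq_one (n : ℕ) : symzDiff F (n + 1) 0 = symzDiff F (n + 1) 1 := by
  have h := detSum_zero_sub_one (complexQuadraticChar_inv (F := F)) n
  rw [MulChar.sum_eq_zero_of_ne_one (complexQuadraticChar_ne_one hF), mul_zero, zero_mul,
    detSum_quadratic_eq_symzDiff, detSum_quadratic_eq_symzDiff, sub_eq_zero] at h
  exact_mod_cast h

omit hF in
theorem detSum_zero_zero (η : MulChar F ℂ) : detSum η 0 0 = 1 := by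
  let _ : Unique (SymmMatrix F 0) :=
    ⟨⟨⟨1, Matrix.isSymm_one⟩⟩, fun A => Subtype.ext (Subsingleton.elim _ _)⟩
  rw [detSum, Fintype.sum_unique]
  simp

omit hF in
theorem symz_zero_zero : symz F 0 0 = 1 := by
  have h := detSum_zero_zero (1 : MulChar F ℂ)
  rw [detSum_one_eq_symz] at h
  exact_mod_cast h

omit hF in
theorem symzDiff_zero_zero : symzDiff F 0 0 = 1 := by
  have h := detSum_zero_zero (complexQuadraticChar F)
  rw [detSum_quadratic_eq_symzDiff] at h
  exact_mod_cast h

end Relations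

/-! ### Pascal recursions for the closed sums -/

section Combinatorics

/-- The sum occurring in the count of odd size, truncated to `N` terms. -/
def oddSum (q : ℚ) (m k N : ℕ) : ℚ :=
  ∑ j ∈ range N, (-1 : ℚ) ^ j * (q - 1) ^ (m + j) *
    qDoubleFactorial q (2 * (m : ℤ) - 2 * (j : ℤ) + 1) *
    (binom k (2 * (j : ℤ) - 1) + (q - 1) * binom k (2 * (j : ℤ)))

/-- The sum occurring in the signed count of even size, truncated to `N` terms. -/
def evenSum (q : ℚ) (m k N : ℕ) : ℚ :=
  ∑ j ∈ range N, (-1 : ℚ) ^ j * (q - 1) ^ (m + j) *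
    qDoubleFactorial q (2 * (m : ℤ) - 2 * (j : ℤ) - 1) *
    (binom k (2 * (j : ℤ)) + (q - 1) * binom k (2 * (j : ℤ) + 1))

theorem binom_of_neg (n : ℕ) {r : ℤ} (hr : r < 0) : binom n r = 0 := if_neg (by omega)

theorem binom_of_lt (n : ℕ) {r : ℤ} (hr : (n : ℤ) < r) : binom n r = 0 := by
  rw [binom, if_pos (by omega), Nat.choose_eq_zero_of_lt (by omega), Nat.cast_zero]

theorem binom_succ (n : ℕ) (r : ℤ) : binom (n + 1) r = binom n r + binom n (r - 1) := by
  rcases lt_trichotomy r 0 with hr | rfl | hr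
  · rw [binom_of_neg _ hr, binom_of_neg _ hr, binom_of_neg _ (by omega), add_zero]
  · simp [binom]
  · obtain ⟨s, rfl⟩ : ∃ s : ℕ, r = s + 1 := ⟨(r - 1).toNat, by omega⟩
    rw [binom, binom, binom, if_pos (by omega), if_pos (by omega), if_pos (by omega),
      show ((s : ℤ) + 1).toNat = s + 1 by omega, show ((s : ℤ) + 1 - 1).toNat = s by omega,
      Nat.choose_succ_succ]
    push_cast
    ring

/-- Both binomials vanish once 2j − 1 > k, so the truncation may be chosen freely beyond that point.
-/
theorem oddSum_eq_of_le (q : ℚ) (m : ℕ) {k N M : ℕ} (hN : k + 2 ≤ 2 * N) (hNM : N ≤ M) :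
    oddSum q m k M = oddSum q m k N := by
  refine (sum_subset (range_mono hNM) fun j _ hj => ?_).symm
  rw [mem_range, not_lt] at hj
  rw [binom_of_lt k (by omega), binom_of_lt k (by omega)]
  ring

theorem evenSum_eq_of_le (q : ℚ) (m : ℕ) {k N M : ℕ} (hN : k + 1 ≤ 2 * N) (hNM : N ≤ M) :
    evenSum q m k M = evenSum q m k N := by
  refine (sum_subset (range_mono hNM) fun j _ hj => ?_).symm
  rw [mem_range, not_lt] at hj
  rw [binom_of_lt k (by omega), binom_of_lt k (by omega)]
  ring

/-- The Pascal increment lowers each lower index by one; shifting j by one turns it into the even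
sum and produces the factor −(q − 1). The j = 0 increment has negative lower indices and vanishes.
This mirrors `symz_odd_succ`. -/
theorem oddSum_succ (q : ℚ) (m k N : ℕ) :
    oddSum q m (k + 1) (N + 1) = oddSum q m k (N + 1) - (q - 1) * evenSum q m k N := by
  have h : oddSum q m (k + 1) (N + 1) - oddSum q m k (N + 1) = -((q - 1) * evenSum q m k N) := by
    rw [oddSum, oddSum, ← sum_sub_distrib, sum_range_succ', evenSum, mul_sum, ← sum_neg_distrib]
    refine (congrArg₂ (· + ·) ?_ ?_).trans (add_zero _)
    · refine sum_congr rfl fun j _ => ?_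
      rw [binom_succ k, binom_succ k]
      push_cast
      rw [show 2 * (m : ℤ) - 2 * ((j : ℤ) + 1) + 1 = 2 * (m : ℤ) - 2 * (j : ℤ) - 1 by ring,
        show 2 * ((j : ℤ) + 1) - 1 - 1 = 2 * (j : ℤ) by ring,
        show 2 * ((j : ℤ) + 1) - 1 = 2 * (j : ℤ) + 1 by ring]
      ring
    · rw [binom_succ k, binom_succ k]
      push_cast
      rw [binom_of_neg k (show (-2 : ℤ) < 0 by norm_num),
        binom_of_neg k (show (-1 : ℤ) < 0 by norm_num)]
      ring
  linear_combination h

/-- The Pascal increment is the odd sum for `m` term by term, with no shift of j. This mirrors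
`symzDiff_even_succ`. -/
theorem evenSum_succ (q : ℚ) (m k N : ℕ) :
    evenSum q (m + 1) (k + 1) N = evenSum q (m + 1) k N + (q - 1) * oddSum q m k N := by
  rw [evenSum, evenSum, oddSum, mul_sum, ← sum_add_distrib]
  refine sum_congr rfl fun j _ => ?_
  rw [binom_succ k, binom_succ k]
  push_cast
  rw [show 2 * ((m : ℤ) + 1) - 2 * (j : ℤ) - 1 = 2 * (m : ℤ) - 2 * (j : ℤ) + 1 by ring,
    show 2 * (j : ℤ) + 1 - 1 = 2 * (j : ℤ) by ring]
  ring

theorem oddSum_zero (q : ℚ) (m : ℕ) :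
    oddSum q m 0 1 = (q - 1) ^ (m + 1) * qDoubleFactorial q (2 * (m : ℤ) + 1) := by
  simp [oddSum, binom]
  ring

theorem evenSum_zero (q : ℚ) (m : ℕ) :
    evenSum q m 0 1 = (q - 1) ^ m * qDoubleFactorial q (2 * (m : ℤ) - 1) := by
  simp [evenSum, binom]

theorem qDoubleFactorial_odd (q : ℚ) (m : ℕ) :
    qDoubleFactorial q (2 * (m : ℤ) + 1) =
      qNumber q (2 * (m : ℤ) + 1) * qDoubleFactorial q (2 * (m : ℤ) - 1) := by
  rw [qDoubleFactorial, qDoubleFactorial, show ((2 * (m : ℤ) + 1 + 1) / 2).toNat = m + 1 by omega,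
    show ((2 * (m : ℤ) - 1 + 1) / 2).toNat = m by omega, prod_range_succ', mul_comm (qNumber q _)]
  congr 1
  · exact prod_congr rfl fun i _ => congrArg (qNumber q) (by push_cast; ring)

theorem sub_one_mul_qNumber {q : ℚ} (hq : q ≠ 1) (m : ℕ) :
    (q - 1) * qNumber q (2 * (m : ℤ) + 1) = q ^ (2 * m + 1) - 1 := by
  rw [qNumber, mul_div_cancel₀ _ (sub_ne_zero.2 hq)]
  norm_cast

end Combinatorics

/-! ### Solving the recursions -/

section ClosedForms

variable {F : Type*} [Field F] [Fintype F] [DecidableEq F]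

theorem quadraticChar_neg_one_sq_rat : ((quadraticChar F (-1) : ℤ) : ℚ) ^ 2 = 1 := by
  have h : quadraticChar F (-1) ^ 2 = 1 := quadraticChar_sq_one (neg_ne_zero.2 one_ne_zero)
  exact_mod_cast h

omit [DecidableEq F] in
theorem one_lt_card_rat : (1 : ℚ) < Fintype.card F := by
  exact_mod_cast Fintype.one_lt_card

variable (hF : ringChar F ≠ 2)
include hF

/-- The value at k = 1 is eliminated between the additive-character relation and the inversion
relation; the next two lemmas do the same. -/
theorem symz_even_zero (m : ℕ) :
    (symz F (2 * m + 2) 0 : ℚ) = (Fintype.card F : ℚ) ^ (2 * m + 2) * symz F (2 * m + 1) 0 := by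
  have h1 := symz_even_succ hF (Nat.zero_le (2 * m + 1))
  have h2 := symz_zero_sub_one (F := F) (2 * m + 1)
  have hq : (Fintype.card F : ℚ) - 1 ≠ 0 := (sub_pos.2 one_lt_card_rat).ne'
  refine mul_left_cancel₀ hq ?_
  linear_combination (Fintype.card F : ℚ) * h2 + h1

theorem symzDiff_even_zero (m : ℕ) :
    symzDiff F (2 * m + 2) 0 =
      ((quadraticChar F (-1) : ℤ) * (Fintype.card F : ℚ)) ^ (m + 1) * symz F (2 * m + 1) 0 := by
  have h1 := symzDiff_even_succ hF (Nat.zero_le (2 * m + 1))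
  have h2 := symzDiff_zero_eq_one hF (2 * m + 1)
  have hq : (Fintype.card F : ℚ) - 1 ≠ 0 := (sub_pos.2 one_lt_card_rat).ne'
  refine mul_left_cancel₀ hq ?_
  linear_combination (Fintype.card F : ℚ) * h2 + h1

theorem symz_odd_zero (m : ℕ) :
    (symz F (2 * m + 1) 0 : ℚ) = (Fintype.card F : ℚ) ^ (2 * m + 1) * symz F (2 * m) 0 -
      ((quadraticChar F (-1) : ℤ) * (Fintype.card F : ℚ)) ^ m * symzDiff F (2 * m) 0 := by
  have h1 := symz_odd_succ hF (Nat.zero_le (2 * m))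
  have h2 := symz_zero_sub_one (F := F) (2 * m)
  have hq : (Fintype.card F : ℚ) - 1 ≠ 0 := (sub_pos.2 one_lt_card_rat).ne'
  refine mul_left_cancel₀ hq ?_
  linear_combination (Fintype.card F : ℚ) * h2 + h1

/-- At k = 0 the two relations force D₀ = D₁ and qD₁ = D₀, so D₀ = 0. Conceptually, scaling by a
nonsquare swaps the two determinant classes in odd size. -/
theorem symzDiff_odd_eq_zero (m : ℕ) : ∀ k ≤ 2 * m + 1, symzDiff F (2 * m + 1) k = 0 := by
  have hq := one_lt_card_rat (F := F)
  intro k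
  induction k with
  | zero =>
    intro _
    have h1 := symzDiff_odd_succ hF (Nat.zero_le (2 * m))
    have h2 := symzDiff_zero_eq_one hF (2 * m)
    refine (mul_eq_zero.1 ?_).resolve_left (sub_pos.2 hq).ne'
    linear_combination (Fintype.card F : ℚ) * h2 + h1
  | succ k ih =>
    intro hk
    have h1 := symzDiff_odd_succ hF (show k ≤ 2 * m by omega)
    rw [ih (by omega)] at h1
    exact (mul_eq_zero.1 h1).resolve_left (by positivity)

theorem symz_even_eq (m : ℕ) : ∀ k ≤ 2 * m,
    (Fintype.card F : ℚ) ^ k * symz F (2 * m) k = symz F (2 * m) 0 := by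
  intro k
  induction k with
  | zero => intro _; simp
  | succ k ih =>
    intro hk
    obtain ⟨l, rfl⟩ : ∃ l, m = l + 1 := ⟨m - 1, by omega⟩
    rw [← ih (by omega), pow_succ, mul_assoc]
    congr 1
    exact symz_even_succ hF (show k ≤ 2 * l + 1 by omega)

/-- The number of invertible symmetric matrices of odd size, and the signed number for even
size. -/
theorem symz_zero_closed_form (m : ℕ) :
    symzDiff F (2 * m) 0 = (quadraticChar F (-1) : ℤ) ^ m * (Fintype.card F : ℚ) ^ m ^ 2 *
      evenSum (Fintype.card F) m 0 1 ∧
    (symz F (2 * m + 1) 0 : ℚ) = (Fintype.card F : ℚ) ^ (m ^ 2 + m) *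
      oddSum (Fintype.card F) m 0 1 := by
  have hs := quadraticChar_neg_one_sq_rat (F := F)
  have hpow : ∀ i : ℕ, ((quadraticChar F (-1) : ℤ) : ℚ) ^ i *
      ((quadraticChar F (-1) : ℤ) : ℚ) ^ i = 1 := fun i => by
    rw [← mul_pow, ← sq, hs, one_pow]
  have hq1 : (Fintype.card F : ℚ) ≠ 1 := one_lt_card_rat.ne'
  simp only [oddSum_zero, evenSum_zero]
  induction m with
  | zero =>
    have h := symz_odd_zero hF 0
    simp only [mul_zero, symz_zero_zero, symzDiff_zero_zero] at h ⊢
    have h1 := qDoubleFactorial_odd (Fintype.card F : ℚ) 0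
    have h2 := sub_one_mul_qNumber hq1 0
    have h3 : qDoubleFactorial (Fintype.card F : ℚ) (-1) = 1 := by simp [qDoubleFactorial]
    simp only [Nat.cast_zero, mul_zero, zero_add, zero_sub, h3] at h1 h2 ⊢
    refine ⟨by simp, ?_⟩
    rw [h]
    push_cast
    linear_combination -(((Fintype.card F : ℚ) - 1) * h1) - h2
  | succ m ih =>
    have hT := symzDiff_even_zero hF m
    have hS := symz_even_zero hF m
    have hO := symz_odd_zero hF (m + 1)
    rw [show 2 * (m + 1) = 2 * m + 2 by ring] at hO ⊢
    have h1 := qDoubleFactorial_odd (Fintype.card F : ℚ) (m + 1)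
    have h2 := sub_one_mul_qNumber hq1 (m + 1)
    have hcast : 2 * ((m + 1 : ℕ) : ℤ) - 1 = 2 * (m : ℤ) + 1 := by push_cast; ring
    rw [hcast] at h1 ⊢
    rw [ih.2] at hT hS
    constructor
    · rw [hT]
      ring
    · rw [hO, hT, hS, h1]
      set s : ℚ := ((quadraticChar F (-1) : ℤ) : ℚ)
      set q : ℚ := (Fintype.card F : ℚ)
      set D : ℚ := qDoubleFactorial q (2 * (m : ℤ) + 1)
      set B : ℚ := qNumber q (2 * ((m + 1 : ℕ) : ℤ) + 1)
      have hp := hpow (m + 1)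
      rw [mul_pow]
      have e1 : q ^ ((m + 1) ^ 2 + (m + 1)) = q ^ (2 * m + 2) * q ^ (m ^ 2 + m) := by
        rw [← pow_add]; congr 1; ring
      have e2 : q ^ (m + 1) * q ^ (m + 1) = q ^ (2 * m + 2) := by
        rw [← pow_add]; congr 1; ring
      rw [e1]
      -- The two signs cancel by `hp`, leaving q^(2m+2)(q^(2m+3) − 1); by `h2` the last factor is (q
      -- − 1)[2m+3]_q.
      linear_combination (-q ^ (2 * m + 2) * q ^ (m ^ 2 + m) * (q - 1) ^ (m + 1) * D) * h2
        - (q ^ (m + 1) * q ^ (m + 1) * q ^ (m ^ 2 + m) * (q - 1) ^ (m + 1) * D) * hp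
        - (q ^ (m ^ 2 + m) * (q - 1) ^ (m + 1) * D) * e2

theorem symz_closed_form (k : ℕ) : ∀ m : ℕ,
    (k ≤ 2 * m → (Fintype.card F : ℚ) ^ k * symzDiff F (2 * m) k =
      (quadraticChar F (-1) : ℤ) ^ m * (Fintype.card F : ℚ) ^ m ^ 2 *
        evenSum (Fintype.card F) m k (k + 1)) ∧
    (k ≤ 2 * m + 1 → (Fintype.card F : ℚ) ^ k * symz F (2 * m + 1) k =
      (Fintype.card F : ℚ) ^ (m ^ 2 + m) * oddSum (Fintype.card F) m k (k + 1)) := by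
  have hs := quadraticChar_neg_one_sq_rat (F := F)
  have hpow : ∀ i : ℕ, ((quadraticChar F (-1) : ℤ) : ℚ) ^ i *
      ((quadraticChar F (-1) : ℤ) : ℚ) ^ i = 1 := fun i => by
    rw [← mul_pow, ← sq, hs, one_pow]
  -- `m` stays universally quantified: size 2l + 2 calls on size 2l + 1, and size 2m + 1 on size 2m.
  induction k with
  | zero =>
    intro m
    have h := symz_zero_closed_form hF m
    simp only [pow_zero, one_mul, zero_add]
    exact ⟨fun _ => h.1, fun _ => h.2⟩
  | succ k ih =>
    intro m
    constructor
    · intro hk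
      obtain ⟨l, rfl⟩ : ∃ l, m = l + 1 := ⟨m - 1, by omega⟩
      have h := symzDiff_even_succ hF (show k ≤ 2 * l + 1 by omega)
      have h1 := (ih (l + 1)).1 (by omega)
      have h2 := (ih l).2 (by omega)
      rw [evenSum_succ,
        evenSum_eq_of_le _ _ (show k + 1 ≤ 2 * (k + 1) by omega) (Nat.le_succ (k + 1))]
      have hodd : oddSum (Fintype.card F) l k (k + 1 + 1) = oddSum (Fintype.card F) l k (k + 1) :=
        oddSum_eq_of_le _ _ (by omega) (Nat.le_succ _)
      rw [hodd]
      rw [show 2 * (l + 1) = 2 * l + 2 by ring] at h1 ⊢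
      rw [mul_pow] at h
      have e : (Fintype.card F : ℚ) ^ (l + 1) ^ 2 =
          (Fintype.card F : ℚ) ^ (l + 1) * (Fintype.card F : ℚ) ^ (l ^ 2 + l) := by
        rw [← pow_add]; congr 1; ring
      rw [e] at h1 ⊢
      rw [pow_succ (Fintype.card F : ℚ) k]
      linear_combination (Fintype.card F : ℚ) ^ k * h + h1 +
        ((Fintype.card F : ℚ) - 1) * ((quadraticChar F (-1) : ℤ) : ℚ) ^ (l + 1) *
          (Fintype.card F : ℚ) ^ (l + 1) * h2
    · intro hk
      have h := symz_odd_succ hF (show k ≤ 2 * m by omega)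
      have h1 := (ih m).1 (by omega)
      have h2 := (ih m).2 (by omega)
      rw [oddSum_succ,
        oddSum_eq_of_le _ _ (show k + 2 ≤ 2 * (k + 1) by omega) (Nat.le_succ (k + 1))]
      have hp := hpow m
      rw [mul_pow] at h
      have e : (Fintype.card F : ℚ) ^ (m ^ 2 + m) =
          (Fintype.card F : ℚ) ^ m * (Fintype.card F : ℚ) ^ m ^ 2 := by
        rw [← pow_add]; congr 1; ring
      rw [e] at h2 ⊢
      rw [pow_succ (Fintype.card F : ℚ) k]
      linear_combination (Fintype.card F : ℚ) ^ k * h + h2 -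
        ((Fintype.card F : ℚ) - 1) * ((quadraticChar F (-1) : ℤ) : ℚ) ^ m *
          (Fintype.card F : ℚ) ^ m * h1 -
        ((Fintype.card F : ℚ) - 1) * (Fintype.card F : ℚ) ^ m * (Fintype.card F : ℚ) ^ m ^ 2 *
          evenSum (Fintype.card F) m k (k + 1) * hp

omit hF in
theorem neg_one_pow_signExp (m : ℕ) :
    (-1 : ℚ) ^ signExp F m = ((quadraticChar F (-1) : ℤ) : ℚ) ^ m := by
  have hne : ((-1 : F) ^ m) ≠ 0 := pow_ne_zero _ (neg_ne_zero.2 one_ne_zero)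
  have h : (quadraticChar F (-1)) ^ m = quadraticChar F ((-1) ^ m) := (map_pow _ _ _).symm
  rw [← Int.cast_pow, h, signExp]
  split_ifs with hsq
  · rw [(quadraticChar_one_iff_isSquare hne).2 hsq]
    simp
  · rw [quadraticChar_neg_one_iff_not_isSquare.2 hsq]
    simp

omit hF [Fintype F] [DecidableEq F] in
theorem sym_eq_symz_zero (n : ℕ) : sym F n = symz F n 0 := by
  rw [sym, symz]
  congr 1
  ext A
  simp [SymInv, Symz]

end ClosedForms

theorem ringChar_ne_two_of_odd_card {F : Type*} [Field F] [Fintype F]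
    (h : Odd (Fintype.card F)) : ringChar F ≠ 2 := fun h2 =>
  (Nat.not_even_iff_odd.2 h) (FiniteField.even_card_of_char_two h2 |> Nat.even_iff.2)

theorem mainTheorem5 {F : Type*} [Field F] [Fintype F] [DecidableEq F]
    (q : ℕ) (hq : Fintype.card F = q) (hodd : Odd q) (m k : ℕ) :
    (k + 1 ≤ 2 * m →
      (symz F (2 * m) (k + 1) : ℚ) = 1 / (q : ℚ) ^ (k + 1) * (sym F (2 * m) : ℚ)) ∧
    (k + 1 ≤ 2 * m + 1 →
      (symz F (2 * m + 1) (k + 1) : ℚ) =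
        (q : ℚ) ^ (m ^ 2 + m) / (q : ℚ) ^ (k + 1) *
          ∑ j ∈ Finset.range (k / 2 + 2),
            (-1 : ℚ) ^ j * ((q : ℚ) - 1) ^ (m + j) *
              qDoubleFactorial (q : ℚ) (2 * (m : ℤ) - 2 * (j : ℤ) + 1) *
              (binom (k + 1) (2 * (j : ℤ) - 1) +
                ((q : ℚ) - 1) * binom (k + 1) (2 * (j : ℤ)))) ∧
    (k + 1 ≤ 2 * m →
      (symzPlus F (2 * m) (k + 1) : ℚ) =
        (sym F (2 * m) : ℚ) / (2 * (q : ℚ) ^ (k + 1)) +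
          (-1 : ℚ) ^ signExp F m * (q : ℚ) ^ (m ^ 2) / (2 * (q : ℚ) ^ (k + 1)) *
            ∑ j ∈ Finset.range ((k + 1) / 2 + 1),
              (-1 : ℚ) ^ j * ((q : ℚ) - 1) ^ (m + j) *
                qDoubleFactorial (q : ℚ) (2 * (m : ℤ) - 2 * (j : ℤ) - 1) *
                (binom (k + 1) (2 * (j : ℤ)) +
                  ((q : ℚ) - 1) * binom (k + 1) (2 * (j : ℤ) + 1))) ∧
    (k + 1 ≤ 2 * m + 1 →
      (symzPlus F (2 * m + 1) (k + 1) : ℚ) =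
        1 / 2 * (symz F (2 * m + 1) (k + 1) : ℚ)) := by
  subst hq
  have hF := ringChar_ne_two_of_odd_card hodd
  have hq0 : (Fintype.card F : ℚ) ^ (k + 1) ≠ 0 :=
    pow_ne_zero _ (zero_lt_one.trans one_lt_card_rat).ne'
  refine ⟨fun hk => ?_, fun hk => ?_, fun hk => ?_, fun hk => ?_⟩
  · rw [sym_eq_symz_zero, ← symz_even_eq hF m (k + 1) hk]
    field_simp
  · have h := (symz_closed_form hF (k + 1) m).2 hk
    -- The induction carries a crude number of terms; those beyond the stated upper limit have
    -- vanishing binomials.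
    have hsum : oddSum (Fintype.card F) m (k + 1) (k + 1 + 1) =
        oddSum (Fintype.card F) m (k + 1) (k / 2 + 2) :=
      oddSum_eq_of_le _ _ (by omega) (by omega)
    rw [hsum] at h
    rw [div_mul_eq_mul_div, eq_div_iff hq0, mul_comm]
    exact h
  · have h := (symz_closed_form hF (k + 1) m).1 hk
    have hsum : evenSum (Fintype.card F) m (k + 1) (k + 1 + 1) =
        evenSum (Fintype.card F) m (k + 1) ((k + 1) / 2 + 1) :=
      evenSum_eq_of_le _ _ (by omega) (by omega)
    rw [hsum, ← neg_one_pow_signExp, symzDiff, mul_sub, symz_even_eq hF m (k + 1) hk,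
      ← sym_eq_symz_zero] at h
    rw [div_mul_eq_mul_div, ← add_div, eq_div_iff (mul_ne_zero two_ne_zero hq0)]
    rw [evenSum] at h
    linear_combination h
  · have h := symzDiff_odd_eq_zero hF m (k + 1) hk
    rw [symzDiff] at h
    linear_combination h / 2
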